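/- Consider a slotted link with state $x=(q,h,a,e_b,e)$: $q\in\mathbb N$ packets are queued, the channel gain is $h>0$, $a\in\mathbb N$ packets and $e\in\mathbb N$ units of harvested energy arrive at the end of the slot, and the battery holds $e_b\in\{0,\dots,E_{\max}\}$ units of energy. The gains, the data arrivals and the energy arrivals are independent finite-state ergodic Markov chains. In state $x$ one chooses $r\in\{0,\dots,q\}$ packets to transmit and a battery power $w\in\{0,1/\tau,\dots,e_b/\tau\}$; then the next queue length is $q-r+a$ and the next battery level is $\min\{e_b-w\tau+e,\,E_{\max}\}$. The power required is $P(x,r)=\rho\frac{\sigma^2}{h}(e^{\theta r}-1)+C\,\mathbf 1_{\{r\neq 0\}}$, with $\theta=2\ln(2)\,b/N$ for positive integers $b$ (bits per packet) and $N$ (channel uses per slot), $\rho\ge 1$, $C\ge 0$, $\sigma^2>0$, $\tau>0$; the grid power is $P_{\rm grid}(x,r,w)=\max\{P(x,r)-w,0\}$. For a policy $\pi$ (randomized, history dependent, choosing feasible actions) and an initial state $x$, write $X[k],R[k],W[k],Q[k]$ for the state, the transmitted packets, the battery power and the queue length in slot $k$, $P_{\rm grid}[k]=P_{\rm grid}(X[k],R[k],W[k])$,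 and let $$B_x^\pi=\limsup_{n\to\infty}\frac1n\,\mathbb E_x^\pi\Big[\sum_{k=0}^{n-1}Q[k]\Big],\qquad K_x^\pi=\limsup_{n\to\infty}\frac1n\,\mathbb E_x^\pi\Big[\sum_{k=0}^{n-1}P_{\rm grid}[k]\Big],$$ $$J_x^\pi(\beta)=\limsup_{n\to\infty}\frac1n\,\mathbb E_x^\pi\Big[\sum_{k=0}^{n-1}\big(Q[k]+\beta P_{\rm grid}[k]\big)\Big].$$ For $\beta>0$, a policy is optimal for ${\rm UP}_\beta$ if it minimizes $J_x^\pi(\beta)$ over all policies $\pi$, for every initial state $x$. Let $0<\beta_1<\beta_2$, and for $i=1,2$ let $g_{\beta_i}$ be a stationary deterministic policy that is optimal for ${\rm UP}_{\beta_i}$. Then for every initial state $x$ $$J_x^{g_{\beta_1}}(\beta_1)\le J_x^{g_{\beta_2}}(\beta_2),\qquad B_x^{g_{\beta_1}}\le B_x^{g_{\beta_2}},\qquad K_x^{g_{\beta_2}}\le K_x^{g_{\beta_1}}.$$ That is, the optimal Lagrangian cost and the average buffer length are non-decreasing in $\beta$, and the average grid power is non-increasing in $\beta$. -/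

import Mathlib

open Filter
open scoped ENNReal

noncomputable section

/-- A finite-state Markov chain, given by its one-step transition law, is ergodic
(irreducible and aperiodic): some power of the transition matrix is entrywise positive. -/
def IsErgodicChain {ι : Type} [Fintype ι] [DecidableEq ι] (p : ι → PMF ι) : Prop :=
  (Matrix.of fun i j => (p i j).toReal).IsPrimitive

/-- The data of the point-to-point block fading link with an energy harvesting battery and the
power grid.  Energy is discretized: it is counted in integer units. -/
structure HarvestModel where
  /-- length of a time slot -/
  τ : ℝ
  τ_pos : 0 < τ
  /-- bits per packet -/
  b : ℕ
  b_pos : 0 < b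
  /-- channel uses per slot -/
  N : ℕ
  N_pos : 0 < N
  /-- variance of the noise -/
  σsq : ℝ
  σsq_pos : 0 < σsq
  ρ : ℝ
  one_le_ρ : 1 ≤ ρ
  /-- circuit power -/
  C : ℝ
  C_nonneg : 0 ≤ C
  /-- battery capacity -/
  Emax : ℕ
  /-- the channel gains, the data arrivals and the energy arrivals that can occur -/
  gains : Finset ℝ
  gains_pos : ∀ h ∈ gains, 0 < h
  arrivals : Finset ℕ
  harvests : Finset ℕ
  /-- transition laws of the channel, data arrival and energy arrival chains -/
  pH : gains → PMF gains
  pA : arrivals → PMF arrivals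
  pE : harvests → PMF harvests
  ergodic_H : IsErgodicChain pH
  ergodic_A : IsErgodicChain pA
  ergodic_E : IsErgodicChain pE

namespace HarvestModel

/-- A state `(q, h, a, e_b, e)`: queue length, channel gain, data arrival, battery energy
(at most the capacity), harvested energy. -/
structure State (M : HarvestModel) where
  q : ℕ
  h : M.gains
  a : M.arrivals
  eb : ℕ
  e : M.harvests
  eb_le : eb ≤ M.Emax

/-- An action: `r` packets are transmitted and `m` units of energy are taken from the battery,
so the power allocated from the battery is `w = m / τ`. -/
structure Action where
  r : ℕ
  m : ℕ

variable (M : HarvestModel)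

/-- Feasibility: `r ∈ {0, …, q}` and `w ∈ {0, 1/τ, …, e_b/τ}`. -/
def Feasible (x : M.State) (u : Action) : Prop := u.r ≤ x.q ∧ u.m ≤ x.eb

/-- `θ = 2 ln(2) b / N`. -/
def θ : ℝ := 2 * Real.log 2 * M.b / M.N

/-- Circuit power: `C` if something is transmitted, and `0` otherwise. -/
def circuit (r : ℕ) : ℝ := if r = 0 then 0 else M.C

/-- The total power required for transmitting `r` packets in state `x`. -/
def power (x : M.State) (r : ℕ) : ℝ :=
  M.ρ * (M.σsq / (x.h : ℝ)) * (Real.exp (M.θ * r) - 1) + M.circuit r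

/-- The power drawn from the grid, `(P(x, r) - w)⁺`. -/
def gridPower (x : M.State) (u : Action) : ℝ :=
  max (M.power x u.r - (u.m : ℝ) / M.τ) 0

/-- The successor of `x` under the action `u` when the three exogenous chains move to
`h'`, `a'`, `e'`: `q' = q - r + a` and `e_b' = min (e_b - w τ + e) E_max`. The truncated
subtractions are genuine ones at feasible actions. -/
def next (x : M.State) (u : Action) (h' : M.gains) (a' : M.arrivals) (e' : M.harvests) :
    M.State where
  q := x.q - u.r + x.a
  h := h'
  a := a'
  eb := min (x.eb - u.m + x.e) M.Emax
  e := e'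
  eb_le := min_le_right _ _

/-- The controlled transition law: the three exogenous chains move independently. -/
def trans (x : M.State) (u : Action) : PMF M.State :=
  (M.pH x.h).bind fun h' => (M.pA x.a).bind fun a' => (M.pE x.e).map fun e' =>
    M.next x u h' a' e'

/-- The past before the current slot: the list of the state-action pairs of the earlier slots,
the most recent one first. -/
abbrev Past : Type := List (M.State × Action)

/-- A policy (randomized and history dependent): given the past and the current state, it chooses
a random action, which is feasible. -/
structure Policy where
  act : M.Past → M.State → PMF Action
  feasible : ∀ l x, ∀ u ∈ (act l x).support, M.Feasible x u

/-- The law, under the policy `π` from the initial state `x`, of the history up to slot `n`: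
the state-action pairs of the slots `0, …, n - 1` together with the state in slot `n`. -/
def historyLaw (π : M.Policy) (x : M.State) : ℕ → PMF (M.Past × M.State)
  | 0 => PMF.pure ([], x)
  | n + 1 => (historyLaw π x n).bind fun p => (π.act p.1 p.2).bind fun u =>
      (M.trans p.2 u).map fun y => ((p.2, u) :: p.1, y)

/-- `E_x^π [∑_{k < n} c (X[k], (R[k], W[k]))]` for a nonnegative one-step cost `c`. -/
def totalCost (c : M.State → Action → ℝ≥0∞) (π : M.Policy) (x : M.State) (n : ℕ) : ℝ≥0∞ :=
  ∑' p : M.Past × M.State, M.historyLaw π x n p * (p.1.map fun s => c s.1 s.2).sum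

/-- The long-run average cost `limsup_n (1/n) E_x^π [∑_{k < n} c (X[k], (R[k], W[k]))]`. -/
def averageCost (c : M.State → Action → ℝ≥0∞) (π : M.Policy) (x : M.State) : ℝ≥0∞ :=
  limsup (fun n : ℕ => M.totalCost c π x n / n) atTop

/-- The average buffer length `B_x^π`. -/
def avgBuffer (π : M.Policy) (x : M.State) : ℝ≥0∞ :=
  M.averageCost (fun s _ => (s.q : ℝ≥0∞)) π x

/-- The average grid power `K_x^π`. -/
def avgGrid (π : M.Policy) (x : M.State) : ℝ≥0∞ :=
  M.averageCost (fun s u => ENNReal.ofReal (M.gridPower s u)) π x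

/-- The average Lagrangian cost `J_x^π(β)`, with one-step cost `q + β P_grid`. -/
def avgLagrangian (β : ℝ) (π : M.Policy) (x : M.State) : ℝ≥0∞ :=
  M.averageCost (fun s u => ENNReal.ofReal (s.q + β * M.gridPower s u)) π x

/-- A stationary deterministic policy: a map from states to feasible actions. -/
structure StationaryPolicy where
  act : M.State → Action
  feasible : ∀ x, M.Feasible x (act x)

variable {M}

/-- A stationary deterministic policy as a policy. -/
def StationaryPolicy.toPolicy (g : M.StationaryPolicy) : M.Policy where
  act _ x := PMF.pure (g.act x)
  feasible _ x u hu := by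
    rw [PMF.support_pure, Set.mem_singleton_iff] at hu
    exact hu ▸ g.feasible x

/-- `π` is optimal for the unconstrained problem with multiplier `β`: from every initial state it
minimizes the average Lagrangian cost among all policies. -/
def Policy.IsOptimal (π : M.Policy) (β : ℝ) : Prop :=
  ∀ (x : M.State) (π' : M.Policy), M.avgLagrangian β π x ≤ M.avgLagrangian β π' x

end HarvestModel

end

/-!
Write `J(β)` for the Lagrangian cost. If the averages over the first `n` slots converged, `J(β)`
would be the sum of the average buffer length and `β` times the average grid power, and adding the
two inequalities that express the optimality of `g₁` and `g₂` would give the claim. Upper limits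
are not additive, so the proof first strengthens optimality: a stationary policy that is optimal
for a cost has an average cost, in the sense of the *upper* limit, which is at most the *lower*
limit of the averages under any stationary policy `g'`
(`HarvestModel.averageCost_le_liminf`). Then both inequalities hold for all large `n`, up to an
arbitrarily small error, and the exchange argument can be made for each such `n`
(`limsup_le_limsup_of_exchange`).

Two facts give the strengthened optimality at a state `x`.

* For a Markov chain on a countable space and a cost with finite sublevel sets, if the average
  cost from `x` is infinitely often at most `l`, then some reachable state `z` has an upper average
  cost of at most `l` (`MarkovChain.exists_reachable_limsup_le`). Along the times where the average
  is at most `l`, the mean occupation measures are tight and have a sub-invariant limit `μ` of mass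
  one with mean cost at most `l`. States `z` charged by `μ` have excursions of finite mean length
  and mean cost, so that average costs from `z` converge by the elementary renewal theorem, which
  follows from the decomposition at the last visit to `z`. By Fatou's lemma one of the limits is at
  most `l`.
* The optimal average cost does not decrease along transitions, hence its value at `x` is at most
  that at `z` (`HarvestModel.averageCost_le_of_mem_support`). It is subharmonic under every feasible
  action, since one may deviate in the first slot and be optimal afterwards. It is bounded, since
  transmitting everything is possible. While the link waits, only the exogenous chain matters; this
  chain is irreducible, so the maximum principle applies to it.
-/

/-! ### Expectations of nonnegative functions -/

/-- The expectation of a nonnegative function under a probability mass function. -/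
noncomputable def PMF.expect {α : Type*} (p : PMF α) (f : α → ℝ≥0∞) : ℝ≥0∞ := ∑' a, p a * f a

namespace PMF

variable {α β : Type*}

lemma expect_pure (a : α) (f : α → ℝ≥0∞) : (PMF.pure a).expect f = f a := by
  rw [expect, tsum_eq_single a]
  · simp
  · intro b hb; simp [hb]

lemma expect_bind (p : PMF α) (k : α → PMF β) (f : β → ℝ≥0∞) :
    (p.bind k).expect f = p.expect fun a => (k a).expect f := by
  simp only [expect, bind_apply, ← ENNReal.tsum_mul_right, ← ENNReal.tsum_mul_left]
  rw [ENNReal.tsum_comm]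
  simp only [mul_assoc]

lemma expect_map (p : PMF α) (k : α → β) (f : β → ℝ≥0∞) :
    (p.map k).expect f = p.expect fun a => f (k a) := by
  rw [← bind_pure_comp, expect_bind]
  simp only [Function.comp, expect_pure]

lemma expect_add (p : PMF α) (f g : α → ℝ≥0∞) :
    (p.expect fun a => f a + g a) = p.expect f + p.expect g := by
  simp only [expect, mul_add, ENNReal.tsum_add]

lemma expect_const (p : PMF α) (c : ℝ≥0∞) : (p.expect fun _ => c) = c := by
  simp [expect, ENNReal.tsum_mul_right]

lemma expect_tsum_mul {ι : Type*} (p : PMF α) (c : ι → ℝ≥0∞) (f : ι → α → ℝ≥0∞) :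
    (p.expect fun a => ∑' i, c i * f i a) = ∑' i, c i * p.expect (f i) := by
  simp only [expect, ← ENNReal.tsum_mul_left]
  rw [ENNReal.tsum_comm]
  simp only [mul_left_comm]

lemma expect_mul_left (p : PMF α) (c : ℝ≥0∞) (f : α → ℝ≥0∞) :
    (p.expect fun a => c * f a) = c * p.expect f := by
  simp only [expect, mul_left_comm _ c, ENNReal.tsum_mul_left]

lemma expect_finset_sum {ι : Type*} (p : PMF α) (s : Finset ι) (f : ι → α → ℝ≥0∞) :
    (p.expect fun a => ∑ i ∈ s, f i a) = ∑ i ∈ s, p.expect (f i) := by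
  simp only [expect, Finset.mul_sum]
  exact Summable.tsum_finsetSum fun _ _ => ENNReal.summable

lemma expect_mono_of_support (p : PMF α) {f g : α → ℝ≥0∞} (h : ∀ a ∈ p.support, f a ≤ g a) :
    p.expect f ≤ p.expect g := by
  refine ENNReal.tsum_le_tsum fun a => ?_
  by_cases ha : a ∈ p.support
  · gcongr; exact h a ha
  · simp [(p.apply_eq_zero_iff a).2 ha]

lemma expect_mono (p : PMF α) {f g : α → ℝ≥0∞} (h : ∀ a, f a ≤ g a) :
    p.expect f ≤ p.expect g :=
  p.expect_mono_of_support fun a _ => h a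

/-- If `f` is bounded by `s < ∞` on the support and its expectation reaches `s`, then `f` equals
`s` on the support. -/
lemma eq_of_le_expect (p : PMF α) {f : α → ℝ≥0∞} {s : ℝ≥0∞} (hs : s ≠ ∞)
    (hf : ∀ a ∈ p.support, f a ≤ s) (h : s ≤ p.expect f) {a : α} (ha : a ∈ p.support) :
    f a = s := by
  refine le_antisymm (hf a ha) (not_lt.1 fun hlt => ?_)
  refine absurd h (not_le.2 ?_)
  rw [← p.expect_const s]
  refine ENNReal.tsum_lt_tsum (i := a) ?_ (fun b => ?_) ?_
  · have : p.expect f ≤ s := by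
      rw [← p.expect_const s]; exact p.expect_mono_of_support hf
    exact ne_top_of_le_ne_top hs this
  · by_cases hb : b ∈ p.support
    · gcongr; exact hf b hb
    · simp [(p.apply_eq_zero_iff b).2 hb]
  · exact (ENNReal.mul_lt_mul_iff_right ((p.mem_support_iff a).1 ha) (p.apply_ne_top a)).2 hlt

end PMF

/-! ### Expected total costs of a Markov chain -/

namespace MarkovChain

variable {S : Type*} (P : S → PMF S)

/-- The transition operator of a Markov chain, acting on nonnegative functions. -/
noncomputable def step (f : S → ℝ≥0∞) : S → ℝ≥0∞ := fun x => (P x).expect f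

/-- The expected cost collected in the slots `0, …, n - 1`, as a function of the initial state. -/
noncomputable def total (f : S → ℝ≥0∞) (n : ℕ) : S → ℝ≥0∞ :=
  fun x => ∑ k ∈ Finset.range n, (step P)^[k] f x

/-- The indicator function of the state `z`. -/
noncomputable def point (z : S) : S → ℝ≥0∞ := Set.indicator {z} 1

/-- The transition operator of the chain killed on its arrival in `z`. -/
noncomputable def tabooStep (z : S) (f : S → ℝ≥0∞) : S → ℝ≥0∞ :=
  step P (Set.indicator {z}ᶜ f)

/-- The expected cost from `z` of the first `n` slots of an excursion, that is, collected before
the first return to `z`. -/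
noncomputable def excursion (z : S) (f : S → ℝ≥0∞) (n : ℕ) : ℝ≥0∞ :=
  ∑ j ∈ Finset.range n, (tabooStep P z)^[j] f z

lemma point_self (z : S) : point z z = 1 := by simp [point]

lemma eq_tsum_point (f : S → ℝ≥0∞) (x : S) : f x = ∑' y, f y * point y x := by
  rw [tsum_eq_single x]
  · simp [point]
  · intro y hy; simp [point, hy.symm]

lemma split_point (z : S) (f : S → ℝ≥0∞) (x : S) :
    f x = Set.indicator {z}ᶜ f x + f z * point z x := by
  by_cases h : x = z
  · subst h; simp [point]
  · simp [point, h]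

lemma iterate_step_tsum {ι : Type*} (c : ι → ℝ≥0∞) (f : ι → S → ℝ≥0∞) (k : ℕ) (x : S) :
    (step P)^[k] (fun y => ∑' i, c i * f i y) x = ∑' i, c i * (step P)^[k] (f i) x := by
  induction k generalizing x with
  | zero => rfl
  | succ k ih =>
    simp only [Function.iterate_succ_apply']
    rw [step, funext ih, PMF.expect_tsum_mul]
    rfl

lemma iterate_step_eq_tsum (f : S → ℝ≥0∞) (k : ℕ) (x : S) :
    (step P)^[k] f x = ∑' y, f y * (step P)^[k] (point y) x := by
  rw [← iterate_step_tsum]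
  exact congrArg (fun g => (step P)^[k] g x) (funext (eq_tsum_point f))

lemma iterate_step_add (f g : S → ℝ≥0∞) (k : ℕ) (x : S) :
    (step P)^[k] (fun y => f y + g y) x = (step P)^[k] f x + (step P)^[k] g x := by
  induction k generalizing x with
  | zero => rfl
  | succ k ih =>
    simp only [Function.iterate_succ_apply']
    rw [step, funext ih, PMF.expect_add]
    rfl

lemma iterate_step_const_mul (c : ℝ≥0∞) (f : S → ℝ≥0∞) (k : ℕ) (x : S) :
    (step P)^[k] (fun y => c * f y) x = c * (step P)^[k] f x := by
  induction k generalizing x with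
  | zero => rfl
  | succ k ih =>
    simp only [Function.iterate_succ_apply']
    rw [step, funext ih, PMF.expect_mul_left]
    rfl

lemma iterate_step_mono {f g : S → ℝ≥0∞} (h : ∀ y, f y ≤ g y) (k : ℕ) (x : S) :
    (step P)^[k] f x ≤ (step P)^[k] g x := by
  induction k generalizing x with
  | zero => exact h x
  | succ k ih =>
    simp only [Function.iterate_succ_apply']
    exact PMF.expect_mono _ ih

lemma iterate_step_const (c : ℝ≥0∞) (k : ℕ) (x : S) : (step P)^[k] (fun _ => c) x = c := by
  induction k generalizing x with
  | zero => rfl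
  | succ k ih =>
    simp only [Function.iterate_succ_apply']
    rw [step, funext ih, PMF.expect_const]

lemma total_succ (f : S → ℝ≥0∞) (n : ℕ) (x : S) :
    total P f (n + 1) x = f x + step P (total P f n) x := by
  rw [total, Finset.sum_range_succ']
  simp only [Function.iterate_succ_apply', Function.iterate_zero, id]
  rw [add_comm, step]
  unfold total
  rw [PMF.expect_finset_sum]
  rfl

lemma total_eq_tsum (f : S → ℝ≥0∞) (n : ℕ) (x : S) :
    total P f n x = ∑' y, f y * total P (point y) n x := by
  simp only [total, Finset.mul_sum]
  rw [Summable.tsum_finsetSum fun _ _ => ENNReal.summable]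
  exact Finset.sum_congr rfl fun k _ => iterate_step_eq_tsum P f k x

lemma total_add (f g : S → ℝ≥0∞) (n : ℕ) (x : S) :
    total P (fun y => f y + g y) n x = total P f n x + total P g n x := by
  simp only [total, iterate_step_add, Finset.sum_add_distrib]

lemma total_const_mul (c : ℝ≥0∞) (f : S → ℝ≥0∞) (n : ℕ) (x : S) :
    total P (fun y => c * f y) n x = c * total P f n x := by
  simp only [total, iterate_step_const_mul, Finset.mul_sum]

lemma total_mono {f g : S → ℝ≥0∞} (h : ∀ y, f y ≤ g y) (n : ℕ) (x : S) :
    total P f n x ≤ total P g n x :=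
  Finset.sum_le_sum fun k _ => iterate_step_mono P h k x

lemma total_const (c : ℝ≥0∞) (n : ℕ) (x : S) : total P (fun _ => c) n x = n * c := by
  simp [total, iterate_step_const]

/-- Changing the initial slot of the sum costs at most one term. -/
lemma total_step_le (f : S → ℝ≥0∞) (n : ℕ) (x : S) :
    total P (step P f) n x ≤ total P f n x + (step P)^[n] f x := by
  rw [total, total, ← Finset.sum_range_succ, Finset.sum_range_succ']
  simp only [Function.iterate_succ_apply]
  exact le_self_add

/-! ### Regeneration at a state -/

/-- Decomposition at the last visit to `z` before or at time `n`. -/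
lemma iterate_step_last_exit (z : S) (f : S → ℝ≥0∞) (n : ℕ) :
    (step P)^[n] f z = ∑ k ∈ Finset.range (n + 1),
      (step P)^[k] (point z) z * (tabooStep P z)^[n - k] f z := by
  induction n generalizing f with
  | zero => simp [point_self]
  | succ n ih =>
    have h : step P f = fun x => tabooStep P z f x + f z * step P (point z) x := by
      funext x
      rw [tabooStep, step, step, step, ← PMF.expect_mul_left, ← PMF.expect_add]
      exact congrArg _ (funext (split_point z f))
    rw [Function.iterate_succ_apply, h, iterate_step_add, iterate_step_const_mul, ih,
      Finset.sum_range_succ _ (n + 1), ← Function.iterate_succ_apply]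
    congr 1
    · refine Finset.sum_congr rfl fun k hk => ?_
      rw [← Function.iterate_succ_apply, Nat.succ_eq_add_one,
        Nat.sub_add_comm (Nat.lt_succ_iff.1 (Finset.mem_range.1 hk))]
    · simp [mul_comm]

lemma total_last_exit (z : S) (f : S → ℝ≥0∞) (N : ℕ) :
    total P f N z = ∑ k ∈ Finset.range N,
      (step P)^[k] (point z) z * excursion P z f (N - k) := by
  induction N with
  | zero => simp [total]
  | succ N ih =>
    have h : total P f (N + 1) z = total P f N z + (step P)^[N] f z :=
      Finset.sum_range_succ _ _
    rw [h, ih, iterate_step_last_exit, Finset.sum_range_succ, Finset.sum_range_succ _ N,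
      ← add_assoc, ← Finset.sum_add_distrib]
    congr 1
    · refine Finset.sum_congr rfl fun k hk => ?_
      rw [← mul_add, Nat.sub_add_comm (Finset.mem_range.1 hk).le]
      congr 1
      exact (Finset.sum_range_succ _ _).symm
    · simp [excursion]

lemma excursion_mono (z : S) (f : S → ℝ≥0∞) : Monotone (excursion P z f) := fun _ _ h =>
  Finset.sum_le_sum_of_subset (Finset.range_subset_range.2 h)

lemma total_le_visits_mul (z : S) (f : S → ℝ≥0∞) (N : ℕ) :
    total P f N z ≤ total P (point z) N z * ⨆ J, excursion P z f J := by
  rw [total_last_exit, total, Finset.sum_mul]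
  gcongr with k hk
  exact le_iSup _ _

lemma visits_mul_le_total (z : S) (f : S → ℝ≥0∞) (N J : ℕ) :
    total P (point z) N z * excursion P z f J ≤ total P f (N + J) z := by
  rw [total_last_exit P z f, total, Finset.sum_mul]
  calc _ ≤ ∑ k ∈ Finset.range N, (step P)^[k] (point z) z * excursion P z f (N + J - k) := by
        gcongr with k hk
        apply excursion_mono
        have := Finset.mem_range.1 hk
        omega
    _ ≤ _ := Finset.sum_le_sum_of_subset (Finset.range_subset_range.2 (by omega))

end MarkovChain

namespace MarkovChain

variable {S : Type*} (P : S → PMF S)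

lemma excursion_one_ne_top (z : S) (J : ℕ) : excursion P z (fun _ => 1) J ≠ ∞ := by
  have h := visits_mul_le_total P z (fun _ => 1) 1 J
  rw [total_const] at h
  refine ne_top_of_le_ne_top ?_ (le_trans (le_of_eq ?_) h)
  · exact ENNReal.mul_ne_top (ENNReal.natCast_ne_top _) ENNReal.one_ne_top
  · simp [total, point_self]

/-- The elementary renewal theorem with rewards: if the mean length and the mean cost of an
excursion from `z` are finite, then the average costs from `z` converge. -/
lemma limsup_average_le_liminf (z : S) (f : S → ℝ≥0∞)
    (hm : ⨆ J, excursion P z (fun _ => 1) J ≠ ∞) (hD : ⨆ J, excursion P z f J ≠ ∞) :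
    limsup (fun n : ℕ => total P f n z / n) atTop ≤
      liminf (fun n : ℕ => total P f n z / n) atTop := by
  set m := ⨆ J, excursion P z (fun _ => 1) J with hm_def
  set D := ⨆ J, excursion P z f J with hD_def
  have hzero (c : ℝ≥0∞) (hc : c ≠ ∞) : Tendsto (fun n : ℕ => c * (n : ℝ≥0∞)⁻¹) atTop (nhds 0) := by
    simpa using ENNReal.Tendsto.const_mul ENNReal.tendsto_inv_nat_nhds_zero (Or.inr hc)
  have hm0 : m ≠ 0 := by
    have : (1 : ℝ≥0∞) ≤ m := by
      refine le_trans (le_of_eq ?_) (le_iSup _ 1)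
      simp [excursion]
    exact (lt_of_lt_of_le one_pos this).ne'
  have upper (J : ℕ) : excursion P z (fun _ => 1) J *
      limsup (fun n : ℕ => total P f n z / n) atTop ≤ D := by
    rw [← ENNReal.limsup_const_mul_of_ne_top (excursion_one_ne_top P z J)]
    have key : ∀ᶠ n : ℕ in atTop, excursion P z (fun _ => 1) J * (total P f n z / n) ≤
        D + D * J * (n : ℝ≥0∞)⁻¹ := by
      filter_upwards [eventually_gt_atTop 0] with n hn
      have hn' : (n : ℝ≥0∞) ≠ 0 := by exact_mod_cast hn.ne'
      have h1 := total_le_visits_mul P z f n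
      have h2 := visits_mul_le_total P z (fun _ => 1) n J
      rw [total_const, mul_one] at h2
      calc _ = (excursion P z (fun _ => 1) J * total P f n z) * (n : ℝ≥0∞)⁻¹ := by
            rw [div_eq_mul_inv, mul_assoc]
        _ ≤ (excursion P z (fun _ => 1) J * (total P (point z) n z * D)) * (n : ℝ≥0∞)⁻¹ := by
            gcongr
        _ = ((total P (point z) n z * excursion P z (fun _ => 1) J) * D) * (n : ℝ≥0∞)⁻¹ := by
            ring
        _ ≤ (((n + J : ℕ) : ℝ≥0∞) * D) * (n : ℝ≥0∞)⁻¹ := by gcongr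
        _ = D * ((n : ℝ≥0∞) * (n : ℝ≥0∞)⁻¹) + D * J * (n : ℝ≥0∞)⁻¹ := by
            push_cast; ring
        _ = _ := by rw [ENNReal.mul_inv_cancel hn' (ENNReal.natCast_ne_top n), mul_one]
    refine (limsup_le_limsup key).trans ((ENNReal.limsup_add_of_right_tendsto_zero
      (hzero _ (ENNReal.mul_ne_top hD (ENNReal.natCast_ne_top J))) fun _ => D).le.trans ?_)
    simp
  have lower (J : ℕ) : excursion P z f J ≤
      m * liminf (fun n : ℕ => total P f n z / n) atTop := by
    have hJ : excursion P z f J ≠ ∞ := ne_top_of_le_ne_top hD (le_iSup _ J)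
    rw [← ENNReal.liminf_const_mul_of_ne_top hm]
    have key : ∀ᶠ n : ℕ in atTop, excursion P z f J ≤
        m * (total P f n z / n) + excursion P z f J * J * (n : ℝ≥0∞)⁻¹ := by
      filter_upwards [eventually_gt_atTop 0, eventually_ge_atTop J] with n hn hnJ
      have hn' : (n : ℝ≥0∞) ≠ 0 := by exact_mod_cast hn.ne'
      obtain ⟨N, rfl⟩ := Nat.exists_eq_add_of_le' hnJ
      have h1 := visits_mul_le_total P z f N J
      have h2 := total_le_visits_mul P z (fun _ => 1) N
      rw [total_const, mul_one] at h2
      calc excursion P z f J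
          = excursion P z f J * (((N + J : ℕ) : ℝ≥0∞) * ((N + J : ℕ) : ℝ≥0∞)⁻¹) := by
            rw [ENNReal.mul_inv_cancel hn' (ENNReal.natCast_ne_top _), mul_one]
        _ = (N * excursion P z f J) * ((N + J : ℕ) : ℝ≥0∞)⁻¹ +
            excursion P z f J * J * ((N + J : ℕ) : ℝ≥0∞)⁻¹ := by push_cast; ring
        _ ≤ ((total P (point z) N z * m) * excursion P z f J) * ((N + J : ℕ) : ℝ≥0∞)⁻¹ +
            excursion P z f J * J * ((N + J : ℕ) : ℝ≥0∞)⁻¹ := by gcongr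
        _ = (m * (total P (point z) N z * excursion P z f J)) * ((N + J : ℕ) : ℝ≥0∞)⁻¹ +
            excursion P z f J * J * ((N + J : ℕ) : ℝ≥0∞)⁻¹ := by ring
        _ ≤ (m * total P f (N + J) z) * ((N + J : ℕ) : ℝ≥0∞)⁻¹ +
            excursion P z f J * J * ((N + J : ℕ) : ℝ≥0∞)⁻¹ := by gcongr
        _ = _ := by rw [div_eq_mul_inv, mul_assoc m]
    have := (liminf_le_liminf key).trans (ENNReal.liminf_add_of_right_tendsto_zero
      (hzero _ (ENNReal.mul_ne_top hJ (ENNReal.natCast_ne_top J))) _).le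
    simpa using this
  rw [← ENNReal.mul_le_mul_iff_right hm0 hm]
  calc _ ≤ D := by rw [hm_def, ENNReal.iSup_mul]; exact iSup_le upper
    _ ≤ _ := iSup_le lower

/-! ### Limits of the mean occupation measures -/

/-- If the average cost from `x` is at most `l` infinitely often, and the cost has finite sublevel
sets, then the mean occupation measures from `x` have a limit along an ultrafilter which is a
probability measure, is sub-invariant and gives the cost at most the mean `l`. -/
lemma exists_subinvariant (f : S → ℝ≥0∞) (hf : ∀ y, f y ≠ ∞)
    (hfin : ∀ K : ℕ, {y | f y < K}.Finite) (x : S) (l : ℝ≥0∞) (hl : l ≠ ∞)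
    (h : ∃ᶠ n : ℕ in atTop, total P f n x / n ≤ l) :
    ∃ μ : S → ℝ≥0∞, ∑' y, μ y = 1 ∧ (∀ g, ∑' y, μ y * step P g y ≤ ∑' y, μ y * g y) ∧
      ∑' y, μ y * f y ≤ l ∧ ∀ z, μ z ≠ 0 → ∃ k, (step P)^[k] (point z) x ≠ 0 := by
  have hne : (atTop ⊓ 𝓟 {n : ℕ | total P f n x / n ≤ l}).NeBot :=
    frequently_mem_iff_neBot.1 h
  let U := Ultrafilter.of (atTop ⊓ 𝓟 {n : ℕ | total P f n x / n ≤ l})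
  have hU : (U : Filter ℕ) ≤ atTop ⊓ 𝓟 {n : ℕ | total P f n x / n ≤ l} := Ultrafilter.of_le _
  have hUtop : (U : Filter ℕ) ≤ atTop := hU.trans inf_le_left
  have hUl : ∀ᶠ n in (U : Filter ℕ), total P f n x / n ≤ l :=
    (hU.trans inf_le_right) (mem_principal_self _)
  have hpos : ∀ᶠ n in (U : Filter ℕ), 0 < n := hUtop (eventually_gt_atTop 0)
  have hex (y : S) : ∃ a, Tendsto (fun n : ℕ => total P (point y) n x / n) U (nhds a) := by
    obtain ⟨a, -, ha⟩ := isCompact_iff_ultrafilter_le_nhds.1 (isCompact_univ (X := ℝ≥0∞))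
      (U.map fun n : ℕ => total P (point y) n x / n) (by simp)
    exact ⟨a, ha⟩
  choose μ hμ using hex
  have hlim (F : Finset S) (g : S → ℝ≥0∞) (hg : ∀ y, g y ≠ ∞) :
      Tendsto (fun n : ℕ => ∑ y ∈ F, (total P (point y) n x / n) * g y) U
        (nhds (∑ y ∈ F, μ y * g y)) :=
    tendsto_finsetSum _ fun y _ => ENNReal.Tendsto.mul_const (hμ y) (Or.inr (hg y))
  have htot (g : S → ℝ≥0∞) (n : ℕ) :
      total P g n x / n = ∑' y, (total P (point y) n x / n) * g y := by
    rw [total_eq_tsum, div_eq_mul_inv, ← ENNReal.tsum_mul_right]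
    exact tsum_congr fun y => by rw [div_eq_mul_inv]; ring
  -- Fatou's lemma for the limit along the ultrafilter.
  have hfatou (g : S → ℝ≥0∞) (hg : ∀ y, g y ≠ ∞) (B : ℝ≥0∞)
      (hB : ∀ᶠ n in (U : Filter ℕ), total P g n x / n ≤ B) : ∑' y, μ y * g y ≤ B := by
    rw [ENNReal.tsum_eq_iSup_sum]
    refine iSup_le fun F => le_of_tendsto (hlim F g hg) ?_
    filter_upwards [hB] with n hn
    refine le_trans ?_ hn
    rw [htot g n]
    exact ENNReal.sum_le_tsum F
  have hle : ∑' y, μ y ≤ 1 := by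
    have := hfatou (fun _ => 1) (by simp) 1 ?_
    · simpa using this
    · filter_upwards [hpos] with n hn
      rw [total_const, mul_one]
      exact ENNReal.div_self_le_one
  -- No mass escapes: by Markov's inequality, all but `l / K` of it is on a sublevel set.
  have hge : 1 ≤ ∑' y, μ y := by
    have hK (K : ℕ) : (K : ℝ≥0∞) ≤ K * ∑' y, μ y + l := by
      have h1 : Tendsto (fun n : ℕ =>
          ∑ y ∈ (hfin K).toFinset, (total P (point y) n x / n) * (K : ℝ≥0∞) + l) U
          (nhds (∑ y ∈ (hfin K).toFinset, μ y * (K : ℝ≥0∞) + l)) :=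
        (hlim _ (fun _ => K) fun _ => ENNReal.natCast_ne_top K).add tendsto_const_nhds
      have h2 : (K : ℝ≥0∞) ≤ ∑ y ∈ (hfin K).toFinset, μ y * (K : ℝ≥0∞) + l := by
        refine ge_of_tendsto h1 ?_
        filter_upwards [hpos, hUl] with n hn hnl
        have hn' : (n : ℝ≥0∞) ≠ 0 := by exact_mod_cast hn.ne'
        have h3 : (K : ℝ≥0∞) = total P (fun _ => K) n x / n := by
          rw [total_const, mul_comm, ENNReal.mul_div_cancel_right hn' (ENNReal.natCast_ne_top n)]
        calc (K : ℝ≥0∞) = total P (fun _ => K) n x / n := h3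
          _ ≤ total P (fun y => Set.indicator {y | f y < K} (fun _ => (K : ℝ≥0∞)) y + f y) n x
              / n := by
              gcongr
              refine total_mono P (fun y => ?_) n x
              by_cases hy : f y < K
              · rw [Set.indicator_of_mem (by exact hy)]; exact le_self_add
              · exact (not_lt.1 hy).trans le_add_self
          _ = total P (Set.indicator {y | f y < K} fun _ => (K : ℝ≥0∞)) n x / n
              + total P f n x / n := by
              rw [total_add, ENNReal.add_div]
          _ ≤ _ := by
              gcongr
              rw [htot, tsum_eq_sum (s := (hfin K).toFinset)]
              · refine Finset.sum_le_sum fun y _ => ?_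
                gcongr
                exact Set.indicator_le_self' (fun _ _ => zero_le) y
              · intro y hy
                rw [Set.indicator_of_notMem (by simpa using hy), mul_zero]
      refine h2.trans ?_
      gcongr
      rw [← Finset.sum_mul, mul_comm]
      gcongr
      exact ENNReal.sum_le_tsum _
    by_contra! hlt
    have hd : 1 - ∑' y, μ y ≠ 0 := (tsub_pos_of_lt hlt).ne'
    have hbd (K : ℕ) : (K : ℝ≥0∞) ≤ l / (1 - ∑' y, μ y) := by
      rw [ENNReal.le_div_iff_mul_le (Or.inl hd) (Or.inl (ne_top_of_le_ne_top
        ENNReal.one_ne_top tsub_le_self)), ENNReal.mul_sub fun _ _ => ENNReal.natCast_ne_top K,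
        mul_one]
      exact tsub_le_iff_left.2 (hK K)
    obtain ⟨K, hK'⟩ := ENNReal.exists_nat_gt (ENNReal.div_ne_top hl hd)
    exact absurd (hbd K) (not_le.2 hK')
  have hpt (z : S) : ∑' y, μ y * step P (point z) y ≤ μ z := by
    have hle1 (y : S) : step P (point z) y ≤ 1 := by
      rw [← (P y).expect_const 1]
      exact PMF.expect_mono _ fun w => Set.indicator_le_self' (fun _ _ => zero_le) w
    refine ENNReal.le_of_forall_pos_le_add fun ε hε _ => ?_
    have hε' : (ε : ℝ≥0∞) ≠ 0 := by exact_mod_cast hε.ne'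
    have h2 : (0 : ℝ≥0∞) < (ε / 2 : NNReal) := by exact_mod_cast half_pos hε
    have h3 : (ε : ℝ≥0∞) = (ε / 2 : NNReal) + (ε / 2 : NNReal) := by
      exact_mod_cast (add_halves ε).symm
    refine hfatou _ (fun y => ne_top_of_le_ne_top ENNReal.one_ne_top (hle1 y)) _ ?_
    have hmu : μ z ≠ ∞ := ne_top_of_le_ne_top ENNReal.one_ne_top ((ENNReal.le_tsum z).trans hle)
    have e1 : ∀ᶠ n : ℕ in U, total P (point z) n x / n < μ z + (ε / 2 : NNReal) :=
      (hμ z).eventually_lt_const (ENNReal.lt_add_right hmu h2.ne')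
    have e2 : ∀ᶠ n : ℕ in U, ((n : ℝ≥0∞))⁻¹ < (ε / 2 : NNReal) :=
      hUtop (ENNReal.tendsto_inv_nat_nhds_zero.eventually_lt_const h2)
    filter_upwards [e1, e2] with n h4 h5
    calc total P (step P (point z)) n x / n
        ≤ (total P (point z) n x + 1) / n := by
          gcongr
          refine (total_step_le P (point z) n x).trans ?_
          gcongr
          rw [← iterate_step_const P 1 n x]
          exact iterate_step_mono P (fun w => Set.indicator_le_self' (fun _ _ => zero_le) w) n x
      _ = total P (point z) n x / n + (n : ℝ≥0∞)⁻¹ := by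
          rw [ENNReal.add_div, one_div]
      _ ≤ μ z + ε := by rw [h3, ← add_assoc]; exact add_le_add h4.le h5.le
  refine ⟨μ, le_antisymm hle hge, fun g => ?_, hfatou f hf l hUl, fun z hz => ?_⟩
  · have hg (y : S) : step P g y = ∑' z, g z * step P (point z) y :=
      iterate_step_eq_tsum P g 1 y
    calc ∑' y, μ y * step P g y = ∑' y, ∑' z, g z * (μ y * step P (point z) y) := by
          refine tsum_congr fun y => ?_
          rw [hg, ← ENNReal.tsum_mul_left]
          exact tsum_congr fun z => by ring
      _ = ∑' z, g z * ∑' y, μ y * step P (point z) y := by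
          rw [ENNReal.tsum_comm]
          exact tsum_congr fun z => ENNReal.tsum_mul_left
      _ ≤ ∑' z, μ z * g z := by
          refine ENNReal.tsum_le_tsum fun z => ?_
          rw [mul_comm]
          gcongr
          exact hpt z
  · by_contra! h0
    refine hz (tendsto_nhds_unique (hμ z) ?_)
    simp [total, h0]

/-- A half of Kac's formula, for sub-invariant measures. -/
lemma mul_excursion_le {μ : S → ℝ≥0∞} (hμ : ∀ g, ∑' y, μ y * step P g y ≤ ∑' y, μ y * g y)
    (z : S) (f : S → ℝ≥0∞) (J : ℕ) : μ z * excursion P z f J ≤ ∑' y, μ y * f y := by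
  induction J generalizing f with
  | zero => simp [excursion]
  | succ J ih =>
    have h1 : excursion P z f (J + 1) = excursion P z (tabooStep P z f) J + f z := by
      rw [excursion, Finset.sum_range_succ']
      rfl
    have h2 : ∑' y, μ y * f y = ∑' y, μ y * Set.indicator {z}ᶜ f y + μ z * f z := by
      have h3 : ∑' y, μ y * point z y = μ z := by
        rw [tsum_eq_single z]
        · simp [point]
        · intro y hy; simp [point, hy]
      rw [← h3, ← ENNReal.tsum_mul_right, ← ENNReal.tsum_add]
      refine tsum_congr fun y => ?_
      conv_lhs => rw [split_point z f y]
      ring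
    rw [h1, h2, mul_add]
    gcongr
    exact (ih _).trans (hμ _)

lemma tsum_mul_total_le {μ : S → ℝ≥0∞}
    (hμ : ∀ g, ∑' y, μ y * step P g y ≤ ∑' y, μ y * g y) (f : S → ℝ≥0∞) (n : ℕ) :
    ∑' y, μ y * total P f n y ≤ n * ∑' y, μ y * f y := by
  induction n with
  | zero => simp [total]
  | succ n ih =>
    simp only [total_succ, mul_add, ENNReal.tsum_add]
    push_cast
    rw [add_mul, one_mul, add_comm]
    gcongr
    exact (hμ _).trans ih

/-- If the average cost from `x` is infinitely often at most `l`, then some state that is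
reachable from `x` has an average cost, in the sense of the upper limit, of at most `l`. -/
theorem exists_reachable_limsup_le (f : S → ℝ≥0∞) (hf : ∀ y, f y ≠ ∞)
    (hfin : ∀ K : ℕ, {y | f y < K}.Finite) (x : S) (l : ℝ≥0∞) (hl : l ≠ ∞)
    (h : ∃ᶠ n : ℕ in atTop, total P f n x / n ≤ l) :
    ∃ z, (∃ k, (step P)^[k] (point z) x ≠ 0) ∧
      limsup (fun n : ℕ => total P f n z / n) atTop ≤ l := by
  obtain ⟨μ, hμ1, hμ, hμf, hreach⟩ := exists_subinvariant P f hf hfin x l hl h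
  have hiSup (z : S) (hz : μ z ≠ 0) (g : S → ℝ≥0∞) (hg : ∑' y, μ y * g y ≠ ∞) :
      ⨆ J, excursion P z g J ≠ ∞ := by
    have h1 : μ z * ⨆ J, excursion P z g J ≤ ∑' y, μ y * g y := by
      rw [ENNReal.mul_iSup]
      exact iSup_le fun J => mul_excursion_le P hμ z g J
    intro htop
    rw [htop, ENNReal.mul_top hz, top_le_iff] at h1
    exact hg h1
  have hfatou : ∑' y, μ y * liminf (fun n : ℕ => total P f n y / n) atTop ≤ l := by
    let _ : MeasurableSpace S := ⊤
    have h1 : ∑' y, liminf (fun n : ℕ => μ y * (total P f n y / n)) atTop ≤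
        liminf (fun n : ℕ => ∑' y, μ y * (total P f n y / n)) atTop := by
      simp only [← MeasureTheory.lintegral_count]
      exact MeasureTheory.lintegral_liminf_le fun n => measurable_from_top
    calc _ = ∑' y, liminf (fun n : ℕ => μ y * (total P f n y / n)) atTop := by
          refine tsum_congr fun y => (ENNReal.liminf_const_mul_of_ne_top ?_).symm
          exact ne_top_of_le_ne_top ENNReal.one_ne_top (hμ1 ▸ ENNReal.le_tsum y)
      _ ≤ _ := h1
      _ ≤ liminf (fun _ : ℕ => l) atTop := by
          refine liminf_le_liminf (Eventually.of_forall fun n => ?_)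
          calc ∑' y, μ y * (total P f n y / n) = (∑' y, μ y * total P f n y) / n := by
                rw [div_eq_mul_inv, ← ENNReal.tsum_mul_right]
                exact tsum_congr fun y => by rw [div_eq_mul_inv, mul_assoc]
            _ ≤ l := ENNReal.div_le_of_le_mul'
                ((tsum_mul_total_le P hμ f n).trans (by gcongr))
      _ = l := by simp
  obtain ⟨z, hz, hzl⟩ : ∃ z, μ z ≠ 0 ∧ liminf (fun n : ℕ => total P f n z / n) atTop ≤ l := by
    by_contra! hcon
    have hle (y : S) : μ y * l ≤ μ y * liminf (fun n : ℕ => total P f n y / n) atTop := by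
      by_cases hy : μ y = 0
      · simp [hy]
      · gcongr; exact (hcon y hy).le
    obtain ⟨z, hz⟩ : ∃ z, μ z ≠ 0 := by
      by_contra! h0
      simp [h0] at hμ1
    have hlt : ∑' y, μ y * l < ∑' y, μ y * liminf (fun n : ℕ => total P f n y / n) atTop := by
      refine ENNReal.tsum_lt_tsum (i := z) ?_ hle ?_
      · rw [ENNReal.tsum_mul_right, hμ1, one_mul]; exact hl
      · exact (ENNReal.mul_lt_mul_iff_right hz
          (ne_top_of_le_ne_top ENNReal.one_ne_top (hμ1 ▸ ENNReal.le_tsum z))).2 (hcon z hz)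
    rw [ENNReal.tsum_mul_right, hμ1, one_mul] at hlt
    exact absurd hfatou (not_le.2 hlt)
  refine ⟨z, hreach z hz, (limsup_average_le_liminf P z f ?_ ?_).trans hzl⟩
  · exact hiSup z hz _ (by simp [hμ1])
  · exact hiSup z hz _ (ne_top_of_le_ne_top hl hμf)

end MarkovChain

/-! ### Closed sets and ergodic chains -/

namespace MarkovChain

lemma total_le_of_closed {S : Type*} (P : S → PMF S) {f : S → ℝ≥0∞} {C : Set S} {K : ℝ≥0∞}
    (hC : ∀ x ∈ C, (P x).support ⊆ C) (hf : ∀ x ∈ C, f x ≤ K) (n : ℕ) {x : S} (hx : x ∈ C) :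
    total P f n x ≤ n * K := by
  induction n generalizing x with
  | zero => simp [total]
  | succ n ih =>
    rw [total_succ, Nat.cast_succ, add_mul, one_mul, add_comm]
    gcongr
    · rw [← (P x).expect_const (n * K)]
      exact (P x).expect_mono_of_support fun y hy => ih (hC x hx hy)
    · exact hf x hx

end MarkovChain

lemma PMF.toReal_pos_iff_mem_support {ι : Type*} (p : PMF ι) (j : ι) :
    0 < (p j).toReal ↔ j ∈ p.support := by
  rw [ENNReal.toReal_pos_iff, PMF.mem_support_iff]
  exact ⟨fun h => h.1.ne', fun h => ⟨pos_iff_ne_zero.2 h, (p.apply_ne_top j).lt_top⟩⟩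

/-- In an ergodic chain, all large powers of the transition matrix are positive. -/
lemma IsErgodicChain.exists_forall_pow_pos {ι : Type} [Fintype ι] [DecidableEq ι]
    {p : ι → PMF ι} (hp : IsErgodicChain p) : ∃ N, ∀ n ≥ N, ∀ i j,
      0 < ((Matrix.of fun i j => (p i j).toReal) ^ n) i j := by
  obtain ⟨hnn, N, -, hN⟩ := hp
  refine ⟨N, fun n hn => Nat.le_induction hN (fun n _ ih i j => ?_) n hn⟩
  obtain ⟨l, hl⟩ := (p i).support_nonempty
  rw [pow_succ', Matrix.mul_apply]
  exact Finset.sum_pos' (fun l _ => mul_nonneg (hnn i l) (ih l j).le)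
    ⟨l, Finset.mem_univ l, mul_pos ((PMF.toReal_pos_iff_mem_support _ _).2 hl) (ih l j)⟩

namespace HarvestModel

variable {M : HarvestModel}

/-! ### Decomposition of the costs of a policy at the first slot -/

/-- The policy that remains of `π` after a first slot with the state-action pair `s`. -/
def Policy.shift (π : M.Policy) (s : M.State × Action) : M.Policy where
  act l y := π.act (l ++ [s]) y
  feasible l := π.feasible (l ++ [s])

/-- The policy that uses `g₀` in the first slot and `g` from then on. -/
noncomputable def StationaryPolicy.followedBy (g₀ g : M.StationaryPolicy) : M.Policy where
  act l y := match l with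
    | [] => PMF.pure (g₀.act y)
    | _ :: _ => PMF.pure (g.act y)
  feasible l y u hu := by
    cases l with
    | nil => exact g₀.toPolicy.feasible [] y u hu
    | cons s l => exact g.toPolicy.feasible [] y u hu

lemma StationaryPolicy.shift_followedBy (g₀ g : M.StationaryPolicy) (s : M.State × Action) :
    (g₀.followedBy g).shift s = g.toPolicy := by
  have : ((g₀.followedBy g).shift s).act = g.toPolicy.act := by
    funext l y
    cases l <;> rfl
  cases h : (g₀.followedBy g).shift s
  cases h' : g.toPolicy
  simp_all

lemma historyLaw_succ_first (π : M.Policy) (x : M.State) (n : ℕ) :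
    M.historyLaw π x (n + 1) = (π.act [] x).bind fun u => (M.trans x u).bind fun y =>
      (M.historyLaw (π.shift (x, u)) y n).map fun p => (p.1 ++ [(x, u)], p.2) := by
  induction n with
  | zero =>
    simp [historyLaw, ← PMF.bind_pure_comp, Function.comp_def]
  | succ n ih =>
    rw [historyLaw, ih]
    simp only [PMF.bind_bind, PMF.bind_map, Function.comp_def]
    congr 1; funext u
    congr 1; funext y
    rw [historyLaw]
    simp only [PMF.map_bind, PMF.map_comp, Function.comp_def, Policy.shift, List.cons_append]

lemma totalCost_succ (c : M.State → Action → ℝ≥0∞) (π : M.Policy) (x : M.State) (n : ℕ) :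
    M.totalCost c π x (n + 1) = (π.act [] x).expect fun u =>
      c x u + (M.trans x u).expect fun y => M.totalCost c (π.shift (x, u)) y n := by
  change (M.historyLaw π x (n + 1)).expect _ = _
  rw [historyLaw_succ_first]
  simp only [PMF.expect_bind, PMF.expect_map, List.map_append, List.sum_append, List.map_cons,
    List.map_nil, List.sum_singleton, PMF.expect_add, PMF.expect_const]
  rw [add_comm]
  rfl

/-- The transition law of the Markov chain that a stationary policy induces. -/
noncomputable def StationaryPolicy.chain (g : M.StationaryPolicy) (x : M.State) : PMF M.State :=
  M.trans x (g.act x)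

lemma StationaryPolicy.totalCost_eq (c : M.State → Action → ℝ≥0∞) (g : M.StationaryPolicy)
    (x : M.State) (n : ℕ) : M.totalCost c g.toPolicy x n =
      MarkovChain.total g.chain (fun y => c y (g.act y)) n x := by
  induction n generalizing x with
  | zero => simp [totalCost, historyLaw, MarkovChain.total, PMF.pure_apply]
  | succ n ih =>
    rw [totalCost_succ, MarkovChain.total_succ]
    change (PMF.pure (g.act x)).expect _ = _
    rw [PMF.expect_pure]
    congr 1
    exact congrArg _ (funext ih)

lemma StationaryPolicy.totalCost_followedBy_succ (c : M.State → Action → ℝ≥0∞)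
    (g₀ g : M.StationaryPolicy) (x : M.State) (n : ℕ) :
    M.totalCost c (g₀.followedBy g) x (n + 1) =
      c x (g₀.act x) + (M.trans x (g₀.act x)).expect fun y => M.totalCost c g.toPolicy y n := by
  rw [totalCost_succ]
  change (PMF.pure (g₀.act x)).expect _ = _
  rw [PMF.expect_pure]
  simp only [StationaryPolicy.shift_followedBy]

/-! ### The exogenous chain -/

/-- The joint state space of the channel, data arrival and energy arrival chains. -/
abbrev Exo (M : HarvestModel) : Type := M.gains × M.arrivals × M.harvests

/-- The exogenous part of a state. -/
def State.exo (x : M.State) : M.Exo := (x.h, x.a, x.e)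

/-- The transition law of the exogenous chain. -/
noncomputable def exoLaw (M : HarvestModel) (w : M.Exo) : PMF M.Exo :=
  (M.pH w.1).bind fun h' => (M.pA w.2.1).bind fun a' => (M.pE w.2.2).map fun e' => (h', a', e')

lemma trans_eq_map (x : M.State) (u : Action) :
    M.trans x u = (M.exoLaw x.exo).map fun w => M.next x u w.1 w.2.1 w.2.2 := by
  simp only [trans, exoLaw, PMF.map_bind, PMF.map_comp, Function.comp_def, State.exo]

lemma mem_support_exoLaw {w w' : M.Exo} : w' ∈ (M.exoLaw w).support ↔
    w'.1 ∈ (M.pH w.1).support ∧ w'.2.1 ∈ (M.pA w.2.1).support ∧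
      w'.2.2 ∈ (M.pE w.2.2).support := by
  obtain ⟨h, a, e⟩ := w'
  simp only [exoLaw, PMF.mem_support_bind_iff, PMF.mem_support_map_iff, Prod.mk.injEq]
  constructor
  · rintro ⟨h', hh, a', ha, e', he, rfl, rfl, rfl⟩
    exact ⟨hh, ha, he⟩
  · rintro ⟨hh, ha, he⟩
    exact ⟨h, hh, a, ha, e, he, rfl, rfl, rfl⟩

/-- The joint exogenous chain is irreducible; this is where aperiodicity matters. -/
lemma eq_univ_of_exo_closed {C : Set M.Exo} (hC : ∀ w ∈ C, (M.exoLaw w).support ⊆ C)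
    {w : M.Exo} (hw : w ∈ C) : C = Set.univ := by
  obtain ⟨N₁, h₁⟩ := IsErgodicChain.exists_forall_pow_pos M.ergodic_H
  obtain ⟨N₂, h₂⟩ := IsErgodicChain.exists_forall_pow_pos M.ergodic_A
  obtain ⟨N₃, h₃⟩ := IsErgodicChain.exists_forall_pow_pos M.ergodic_E
  have key (n : ℕ) : ∀ w' : M.Exo,
      0 < ((Matrix.of fun i j => (M.pH i j).toReal) ^ n) w.1 w'.1 →
      0 < ((Matrix.of fun i j => (M.pA i j).toReal) ^ n) w.2.1 w'.2.1 →
      0 < ((Matrix.of fun i j => (M.pE i j).toReal) ^ n) w.2.2 w'.2.2 → w' ∈ C := by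
    have hstep {ι : Type} [Fintype ι] [DecidableEq ι] (p : ι → PMF ι) (n : ℕ) (i j : ι)
        (h : 0 < ((Matrix.of fun i j => (p i j).toReal) ^ (n + 1)) i j) :
        ∃ l, 0 < ((Matrix.of fun i j => (p i j).toReal) ^ n) i l ∧ j ∈ (p l).support := by
      rw [pow_succ, Matrix.mul_apply] at h
      obtain ⟨l, -, hl⟩ := Finset.exists_lt_of_sum_lt
        ((Finset.sum_const_zero (s := Finset.univ (α := ι))).trans_lt h)
      have hl2 : 0 ≤ (Matrix.of fun i j => (p i j).toReal) l j := ENNReal.toReal_nonneg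
      have hl3 : 0 < (Matrix.of fun i j => (p i j).toReal) l j :=
        lt_of_le_of_ne hl2 fun h0 => by rw [← h0, mul_zero] at hl; exact lt_irrefl _ hl
      exact ⟨l, pos_of_mul_pos_left hl hl2, (PMF.toReal_pos_iff_mem_support _ _).1 hl3⟩
    induction n with
    | zero =>
      intro w' a b c
      have hone {ι : Type} [Fintype ι] [DecidableEq ι] (A : Matrix ι ι ℝ) (i j : ι)
          (h : 0 < (A ^ 0) i j) : i = j := by
        by_contra hne
        simp [Matrix.one_apply_ne hne] at h
      have : w' = w :=
        Prod.ext (hone _ _ _ a).symm (Prod.ext (hone _ _ _ b).symm (hone _ _ _ c).symm)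
      exact this ▸ hw
    | succ n ih =>
      intro w' a b c
      obtain ⟨h, a₁, a₂⟩ := hstep _ _ _ _ a
      obtain ⟨a, b₁, b₂⟩ := hstep _ _ _ _ b
      obtain ⟨e, c₁, c₂⟩ := hstep _ _ _ _ c
      exact hC (h, a, e) (ih (h, a, e) a₁ b₁ c₁) (mem_support_exoLaw.2 ⟨a₂, b₂, c₂⟩)
  refine Set.eq_univ_of_forall fun w' => key (max N₁ (max N₂ N₃)) w' ?_ ?_ ?_
  · exact h₁ _ (le_max_left _ _) _ _
  · exact h₂ _ ((le_max_left _ _).trans (le_max_right _ _)) _ _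
  · exact h₃ _ ((le_max_right _ _).trans (le_max_right _ _)) _ _

/-- The maximum principle for the exogenous chain: a bounded subharmonic function is constant. -/
lemma exo_eq_of_subharmonic {φ : M.Exo → ℝ≥0∞} (hfin : ∀ w, φ w ≠ ∞)
    (hφ : ∀ w, φ w ≤ (M.exoLaw w).expect φ) (w w' : M.Exo) : φ w = φ w' := by
  have : Nonempty M.Exo := ⟨w⟩
  obtain ⟨v, hv⟩ := Finite.exists_max φ
  have hC : {w | φ w = φ v} = Set.univ := by
    refine eq_univ_of_exo_closed (fun u hu => ?_) (w := v) rfl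
    intro u' hu'
    exact (M.exoLaw u).eq_of_le_expect (hfin v) (fun a _ => hv a)
      (le_trans (le_of_eq (Eq.symm hu)) (hφ u)) hu'
  have h (u : M.Exo) : φ u = φ v := (Set.eq_univ_iff_forall.1 hC) u
  rw [h w, h w']

/-! ### The optimal average cost along transitions -/

lemma finite_queue_le (Q : ℕ) : {x : M.State | x.q ≤ Q}.Finite := by
  let F : {x : M.State | x.q ≤ Q} →
      Fin (Q + 1) × M.gains × M.arrivals × Fin (M.Emax + 1) × M.harvests := fun x =>
    (⟨x.1.q, Nat.lt_succ_of_le x.2⟩, x.1.h, x.1.a, ⟨x.1.eb, Nat.lt_succ_of_le x.1.eb_le⟩, x.1.e)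
  have hF : Function.Injective F := by
    rintro ⟨⟨q, h, a, eb, e, he⟩, hx⟩ ⟨⟨q', h', a', eb', e', he'⟩, hx'⟩ hxy
    simp only [F, Prod.mk.injEq, Fin.mk.injEq] at hxy
    obtain ⟨rfl, rfl, rfl, rfl, rfl⟩ := hxy
    rfl
  exact Finite.of_injective F hF

lemma support_trans_finite (x : M.State) (u : Action) : (M.trans x u).support.Finite := by
  rw [trans_eq_map, PMF.support_map]
  exact (Set.toFinite _).image _

variable {c : M.State → Action → ℝ≥0∞} {g : M.StationaryPolicy}

/-- The policy that transmits the whole queue and leaves the battery alone. -/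
def transmitAll (M : HarvestModel) : M.StationaryPolicy where
  act x := ⟨x.q, 0⟩
  feasible _ := ⟨le_rfl, Nat.zero_le _⟩

lemma support_transmitAll (x : M.State) {y : M.State}
    (hy : y ∈ (M.trans x (M.transmitAll.act x)).support) : y.q ≤ M.arrivals.sup id := by
  rw [trans_eq_map, PMF.support_map] at hy
  obtain ⟨w, -, rfl⟩ := hy
  simp only [next, transmitAll, Nat.sub_self, zero_add]
  exact Finset.le_sup (f := id) x.a.2

/-- Transmitting everything keeps the state in a finite set, which bounds the optimal cost. -/
lemma exists_averageCost_le (hc : ∀ s u, c s u ≠ ∞)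
    (hg : ∀ x π, M.averageCost c g.toPolicy x ≤ M.averageCost c π x) (Q : ℕ) :
    ∃ K ≠ ∞, ∀ x : M.State, x.q ≤ Q → M.averageCost c g.toPolicy x ≤ K := by
  let Q' := max Q (M.arrivals.sup id)
  have hfin := M.finite_queue_le Q'
  let K := ∑ y ∈ hfin.toFinset, c y (M.transmitAll.act y)
  refine ⟨K, ENNReal.sum_ne_top.2 fun y _ => hc _ _,
    fun x hx => (hg x M.transmitAll.toPolicy).trans ?_⟩
  have hx' : x ∈ {x : M.State | x.q ≤ Q'} := hx.trans (le_max_left _ _)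
  refine (limsup_le_limsup (v := fun _ => K) (Eventually.of_forall fun n => ?_)).trans (by simp)
  refine ENNReal.div_le_of_le_mul' ?_
  rw [StationaryPolicy.totalCost_eq]
  refine MarkovChain.total_le_of_closed _ (C := {x : M.State | x.q ≤ Q'}) (fun y _ z hz => ?_)
    (fun y hy => ?_) n hx'
  · exact (support_transmitAll y hz).trans (le_max_right _ _)
  · exact Finset.single_le_sum (f := fun y => c y (M.transmitAll.act y)) (fun _ _ => zero_le)
      (hfin.mem_toFinset.2 hy)

/-- The optimal average cost is subharmonic under every feasible action: one may play that action
first and the optimal policy afterwards. -/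
lemma averageCost_le_expect (hc : ∀ s u, c s u ≠ ∞)
    (hg : ∀ x π, M.averageCost c g.toPolicy x ≤ M.averageCost c π x)
    {x : M.State} {u : Action} (hu : M.Feasible x u) :
    M.averageCost c g.toPolicy x ≤ (M.trans x u).expect (M.averageCost c g.toPolicy) := by
  classical
  let g₀ : M.StationaryPolicy :=
    { act := fun y => if y = x then u else ⟨0, 0⟩
      feasible := fun y => by
        split_ifs with h
        · exact h ▸ hu
        · exact ⟨Nat.zero_le _, Nat.zero_le _⟩ }
  have hg₀ : g₀.act x = u := if_pos rfl
  refine (hg x (g₀.followedBy g)).trans (ENNReal.le_of_forall_pos_le_add fun ε hε _ => ?_)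
  have hε' : (ε : ℝ≥0∞) ≠ 0 := by exact_mod_cast hε.ne'
  rw [averageCost, ← limsup_nat_add _ 1]
  have hzero : Tendsto (fun n : ℕ => c x u * (n : ℝ≥0∞)⁻¹) atTop (nhds 0) := by
    simpa using ENNReal.Tendsto.const_mul ENNReal.tendsto_inv_nat_nhds_zero (Or.inr (hc x u))
  have hev : ∀ᶠ n : ℕ in atTop, ∀ y ∈ (M.trans x u).support,
      M.totalCost c g.toPolicy y n / n ≤ M.averageCost c g.toPolicy y + ε := by
    rw [eventually_all_finite (support_trans_finite x u)]
    intro y _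
    by_cases htop : M.averageCost c g.toPolicy y = ∞
    · simp [htop]
    · have hlt := ENNReal.lt_add_right htop hε'
      filter_upwards [eventually_lt_of_limsup_lt hlt] with n hn using hn.le
  have hbound : ∀ᶠ n : ℕ in atTop,
      M.totalCost c (g₀.followedBy g) x (n + 1) / ((n + 1 : ℕ) : ℝ≥0∞) ≤
      ((M.trans x u).expect (M.averageCost c g.toPolicy) + ε) + c x u * (n : ℝ≥0∞)⁻¹ := by
    filter_upwards [hev] with n hn
    rw [StationaryPolicy.totalCost_followedBy_succ, hg₀]
    calc _ ≤ (c x u + (M.trans x u).expect fun y => M.totalCost c g.toPolicy y n) / n := by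
          gcongr
          omega
      _ = (M.trans x u).expect (fun y => M.totalCost c g.toPolicy y n / n) +
          c x u * (n : ℝ≥0∞)⁻¹ := by
          rw [add_comm, ENNReal.add_div]
          congr 1
          simp only [div_eq_mul_inv, mul_comm _ ((n : ℝ≥0∞)⁻¹), PMF.expect_mul_left]
      _ ≤ _ := by
          gcongr
          refine ((M.trans x u).expect_mono_of_support hn).trans (le_of_eq ?_)
          rw [PMF.expect_add, PMF.expect_const]
  refine (limsup_le_limsup hbound).trans
    ((ENNReal.limsup_add_of_right_tendsto_zero hzero fun _ => _).le.trans ?_)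
  simp

/-- The optimal average cost does not decrease along transitions. Waiting keeps the queue and the
battery at least as full as they are after the transition, until the exogenous chain is back in
the exogenous part of `x`; then the same transition can be made. If `u` is not feasible at `x`,
the truncated subtractions in `next` make it act like a feasible action. -/
lemma averageCost_le_of_mem_support (hc : ∀ s u, c s u ≠ ∞)
    (hg : ∀ x π, M.averageCost c g.toPolicy x ≤ M.averageCost c π x)
    {x z : M.State} {u : Action} (hz : z ∈ (M.trans x u).support) :
    M.averageCost c g.toPolicy x ≤ M.averageCost c g.toPolicy z := by
  set F := M.averageCost c g.toPolicy with hF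
  -- The states from which the queue and the battery can be brought to the levels of `z`.
  let D : Set M.State := {y | x.q - u.r ≤ y.q ∧ x.eb - u.m ≤ y.eb}
  -- Their largest optimal cost, for each exogenous part.
  let φ : M.Exo → ℝ≥0∞ := fun w => ⨆ y : {y : M.State // y ∈ D ∧ y.exo = w}, F y
  have hle {y : M.State} (hy : y ∈ D) : F y ≤ φ y.exo :=
    le_iSup (fun y' : {y' : M.State // y' ∈ D ∧ y'.exo = y.exo} => F y') ⟨y, hy, rfl⟩
  obtain ⟨K, hK, hKF⟩ := exists_averageCost_le hc hg (M.arrivals.sup id)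
  have hbdd (y : M.State) : F y ≤ K := by
    refine (averageCost_le_expect hc hg (M.transmitAll.feasible y)).trans ?_
    refine (PMF.expect_mono_of_support _ fun w hw => hKF w (support_transmitAll y hw)).trans ?_
    rw [PMF.expect_const]
  have hφK (w : M.Exo) : φ w ≤ K := iSup_le fun y => hbdd y
  have hsub (w : M.Exo) : φ w ≤ (M.exoLaw w).expect φ := by
    refine iSup_le ?_
    rintro ⟨y, hy, rfl⟩
    refine (averageCost_le_expect hc hg (x := y) (u := ⟨0, 0⟩)
      ⟨Nat.zero_le _, Nat.zero_le _⟩).trans ?_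
    rw [trans_eq_map, PMF.expect_map]
    refine PMF.expect_mono _ fun w => hle (y := M.next y ⟨0, 0⟩ w.1 w.2.1 w.2.2) ⟨?_, ?_⟩
    · simpa [next] using hy.1.trans (Nat.le_add_right _ _)
    · have h1 := hy.2
      have h2 := y.eb_le
      simp only [next]
      omega
  have hconst := exo_eq_of_subharmonic (fun w => ne_top_of_le_ne_top hK (hφK w)) hsub
  -- At the exogenous state of `x`, every state of `D` can imitate the transition.
  have himit : φ x.exo ≤ (M.trans x u).expect F := by
    refine iSup_le ?_
    rintro ⟨y, hy, hyx⟩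
    refine (averageCost_le_expect hc hg (x := y)
      (u := ⟨y.q - (x.q - u.r), y.eb - (x.eb - u.m)⟩)
      ⟨Nat.sub_le _ _, Nat.sub_le _ _⟩).trans (le_of_eq ?_)
    rw [trans_eq_map, trans_eq_map, hyx]
    congr 2
    funext w
    have ha : y.a = x.a := congrArg (fun w : M.Exo => w.2.1) hyx
    have he : y.e = x.e := congrArg (fun w : M.Exo => w.2.2) hyx
    have h1 : y.q - (y.q - (x.q - u.r)) = x.q - u.r := Nat.sub_sub_self hy.1
    have h2 : y.eb - (y.eb - (x.eb - u.m)) = x.eb - u.m := Nat.sub_sub_self hy.2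
    simp only [next, h1, h2, ha, he]
  have hnext {y : M.State} (hy : y ∈ (M.trans x u).support) : y ∈ D := by
    rw [trans_eq_map, PMF.support_map] at hy
    obtain ⟨w, -, rfl⟩ := hy
    have h2 := x.eb_le
    constructor
    · simp only [next]; omega
    · simp only [next]; omega
  have hzs : F z = φ x.exo :=
    (M.trans x u).eq_of_le_expect (ne_top_of_le_ne_top hK (hφK _))
      (fun y hy => (hle (hnext hy)).trans (hconst _ _).le) himit hz
  rw [hzs]
  exact hle (y := x) ⟨Nat.sub_le _ _, Nat.sub_le _ _⟩

lemma averageCost_le_of_reachable (hc : ∀ s u, c s u ≠ ∞)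
    (hg : ∀ x π, M.averageCost c g.toPolicy x ≤ M.averageCost c π x)
    (g' : M.StationaryPolicy) {x z : M.State} {k : ℕ}
    (hk : (MarkovChain.step g'.chain)^[k] (MarkovChain.point z) x ≠ 0) :
    M.averageCost c g.toPolicy x ≤ M.averageCost c g.toPolicy z := by
  induction k generalizing x with
  | zero =>
    have : x = z := by
      by_contra hne
      exact hk (by simp [MarkovChain.point, hne])
    rw [this]
  | succ k ih =>
    rw [Function.iterate_succ_apply'] at hk
    obtain ⟨y, hy⟩ : ∃ y, g'.chain x y *
        (MarkovChain.step g'.chain)^[k] (MarkovChain.point z) y ≠ 0 := by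
      by_contra! h0
      exact hk (ENNReal.tsum_eq_zero.2 h0)
    exact (averageCost_le_of_mem_support hc hg
      ((PMF.mem_support_iff _ _).2 (left_ne_zero_of_mul hy))).trans
      (ih (right_ne_zero_of_mul hy))

/-- Even the lower limit of the average costs of a stationary policy is at least the optimal
average cost. -/
theorem averageCost_le_liminf (hc : ∀ s u, c s u ≠ ∞) (hq : ∀ s u, (s.q : ℝ≥0∞) ≤ c s u)
    (hg : ∀ x π, M.averageCost c g.toPolicy x ≤ M.averageCost c π x)
    (g' : M.StationaryPolicy) (x : M.State) :
    M.averageCost c g.toPolicy x ≤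
      liminf (fun n : ℕ => M.totalCost c g'.toPolicy x n / n) atTop := by
  refine le_of_forall_gt_imp_ge_of_dense fun l hl => ?_
  by_cases htop : l = ∞
  · simp [htop]
  simp only [StationaryPolicy.totalCost_eq] at hl
  obtain ⟨z, ⟨k, hk⟩, hz⟩ := MarkovChain.exists_reachable_limsup_le g'.chain
    (fun y => c y (g'.act y)) (fun y => hc _ _) (fun K => (M.finite_queue_le K).subset fun y hy =>
      Nat.cast_le.1 ((hq _ _).trans (le_of_lt hy))) x l htop
    ((frequently_lt_of_liminf_lt (by isBoundedDefault) hl).mono fun n hn => le_of_lt hn)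
  refine (averageCost_le_of_reachable hc hg g' hk).trans ((hg z g'.toPolicy).trans ?_)
  simpa only [averageCost, StationaryPolicy.totalCost_eq] using hz

end HarvestModel

/-! ### Comparison of two multipliers -/

lemma ENNReal.eventually_le_add_of_limsup_le_liminf {u v : ℕ → ℝ≥0∞}
    (h : limsup u atTop ≤ liminf v atTop) (hu : limsup u atTop ≠ ∞) {ε : NNReal} (hε : 0 < ε) :
    ∀ᶠ n in atTop, u n ≤ v n + ε ∧ u n ≠ ∞ := by
  have h2 : (0 : ℝ≥0∞) < (ε / 2 : NNReal) := by exact_mod_cast half_pos hε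
  have h3 : (ε : ℝ≥0∞) = (ε / 2 : NNReal) + (ε / 2 : NNReal) := by
    exact_mod_cast (add_halves ε).symm
  have e1 := eventually_lt_of_limsup_lt (ENNReal.lt_add_right hu h2.ne')
  have e2 : ∀ᶠ n in atTop, limsup u atTop ≤ v n + (ε / 2 : NNReal) := by
    by_cases h0 : limsup u atTop = 0
    · simp [h0]
    · have hlt : limsup u atTop - (ε / 2 : NNReal) < liminf v atTop :=
        (ENNReal.sub_lt_self hu h0 h2.ne').trans_le h
      filter_upwards [eventually_lt_of_lt_liminf hlt] with n hn
      exact tsub_le_iff_right.1 (le_of_lt hn)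
  filter_upwards [e1, e2] with n h4 h5
  refine ⟨?_, ne_top_of_lt h4⟩
  rw [h3, ← add_assoc]
  exact (le_of_lt h4).trans (by gcongr)

lemma ENNReal.limsup_le_limsup_of_forall_eventually_le_add {u v : ℕ → ℝ≥0∞}
    (h : ∀ ε : NNReal, 0 < ε → ∀ᶠ n in atTop, u n ≤ v n + ε) :
    limsup u atTop ≤ limsup v atTop := by
  refine ENNReal.le_of_forall_pos_le_add fun ε hε _ => ?_
  refine (limsup_le_limsup (h ε hε)).trans (le_of_eq ?_)
  exact limsup_add_const atTop v ε (by isBoundedDefault) (by isBoundedDefault)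

/-- The exchange argument behind the monotonicity in the multiplier: adding the two optimality
inequalities cancels the first cost and compares the second one. -/
lemma limsup_le_limsup_of_exchange {a₁ b₁ a₂ b₂ : ℕ → ℝ≥0∞} {β₁ β₂ : NNReal}
    (hβ₁ : 0 < β₁) (hβ : β₁ < β₂)
    (h₁ : limsup (fun n => a₁ n + β₁ * b₁ n) atTop ≤ liminf (fun n => a₂ n + β₁ * b₂ n) atTop)
    (hfin₁ : limsup (fun n => a₁ n + β₁ * b₁ n) atTop ≠ ∞)
    (h₂ : limsup (fun n => a₂ n + β₂ * b₂ n) atTop ≤ liminf (fun n => a₁ n + β₂ * b₁ n) atTop)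
    (hfin₂ : limsup (fun n => a₂ n + β₂ * b₂ n) atTop ≠ ∞) :
    limsup a₁ atTop ≤ limsup a₂ atTop ∧ limsup b₂ atTop ≤ limsup b₁ atTop := by
  have key (ε : NNReal) (hε : 0 < ε) : ∀ᶠ n in atTop,
      a₁ n ≤ a₂ n + (β₁ + β₂) * ε ∧ b₂ n ≤ b₁ n + 2 * ε := by
    have hβ₂ : 0 < β₂ := hβ₁.trans hβ
    have hδ : 0 < (β₂ - β₁) * ε := mul_pos (tsub_pos_of_lt hβ) hε
    filter_upwards [ENNReal.eventually_le_add_of_limsup_le_liminf h₁ hfin₁ hδ,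
      ENNReal.eventually_le_add_of_limsup_le_liminf h₂ hfin₂ hδ] with n ⟨i₁, f₁⟩ ⟨i₂, f₂⟩
    have hb (β : NNReal) (hβ : 0 < β) {b : ℝ≥0∞} (h : β * b ≠ ∞) : b ≠ ∞ := by
      rintro rfl
      exact h (ENNReal.mul_top (by exact_mod_cast hβ.ne'))
    obtain ⟨fa₁, fb₁⟩ := ENNReal.add_ne_top.1 f₁
    obtain ⟨fa₂, fb₂⟩ := ENNReal.add_ne_top.1 f₂
    generalize a₁ n = A₁ at *
    generalize b₁ n = B₁ at *
    generalize a₂ n = A₂ at *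
    generalize b₂ n = B₂ at *
    lift A₁ to NNReal using fa₁
    lift A₂ to NNReal using fa₂
    lift B₁ to NNReal using hb _ hβ₁ fb₁
    lift B₂ to NNReal using hb _ hβ₂ fb₂
    norm_cast at i₁ i₂ ⊢
    have hδ' : (((β₂ - β₁) * ε : NNReal) : ℝ) = (β₂ - β₁) * ε := by
      rw [NNReal.coe_mul, NNReal.coe_sub hβ.le]
    rw [← NNReal.coe_le_coe] at i₁ i₂
    push_cast only [NNReal.coe_add, NNReal.coe_mul] at i₁ i₂ hδ'
    have hβ' : (0 : ℝ) < β₂ - β₁ := sub_pos.2 (by exact_mod_cast hβ)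
    have hB : (B₂ : ℝ) ≤ B₁ + 2 * ε := by
      refine le_of_mul_le_mul_left ?_ hβ'
      linarith
    refine ⟨?_, by exact_mod_cast hB⟩
    have := mul_le_mul_of_nonneg_left hB (NNReal.coe_nonneg β₁)
    have hA : (A₁ : ℝ) ≤ A₂ + (β₁ + β₂) * ε := by linarith
    exact_mod_cast hA
  constructor
  · refine ENNReal.limsup_le_limsup_of_forall_eventually_le_add fun ε hε => ?_
    have hs : 0 < β₁ + β₂ := add_pos hβ₁ (hβ₁.trans hβ)
    filter_upwards [key (ε / (β₁ + β₂)) (div_pos hε hs)] with n hn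
    have h : (β₁ + β₂) * (ε / (β₁ + β₂)) = ε := mul_div_cancel₀ _ hs.ne'
    refine hn.1.trans (le_of_eq ?_)
    congr 1
    exact_mod_cast h
  · refine ENNReal.limsup_le_limsup_of_forall_eventually_le_add fun ε hε => ?_
    filter_upwards [key (ε / 2) (half_pos hε)] with n hn
    have h : 2 * (ε / 2) = ε := mul_div_cancel₀ _ two_ne_zero
    refine hn.2.trans (le_of_eq ?_)
    congr 1
    exact_mod_cast h

namespace HarvestModel

variable {M : HarvestModel}

lemma ofReal_lagrangian {β : ℝ} (hβ : 0 ≤ β) (s : M.State) (u : Action) :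
    ENNReal.ofReal (s.q + β * M.gridPower s u) =
      s.q + β.toNNReal * ENNReal.ofReal (M.gridPower s u) := by
  have hp : 0 ≤ M.gridPower s u := le_max_right _ _
  rw [ENNReal.ofReal_add (Nat.cast_nonneg _) (mul_nonneg hβ hp),
    ENNReal.ofReal_natCast, ENNReal.ofReal_mul hβ]
  rfl

lemma StationaryPolicy.totalCost_lagrangian {β : ℝ} (hβ : 0 ≤ β) (g : M.StationaryPolicy)
    (x : M.State) (n : ℕ) :
    M.totalCost (fun s u => ENNReal.ofReal (s.q + β * M.gridPower s u)) g.toPolicy x n / n =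
      M.totalCost (fun s _ => (s.q : ℝ≥0∞)) g.toPolicy x n / n + β.toNNReal *
        (M.totalCost (fun s u => ENNReal.ofReal (M.gridPower s u)) g.toPolicy x n / n) := by
  simp only [StationaryPolicy.totalCost_eq, ofReal_lagrangian hβ]
  rw [MarkovChain.total_add, MarkovChain.total_const_mul, ENNReal.add_div, mul_div_assoc]

/-- A stationary policy that is optimal for the multiplier `β` has a finite average Lagrangian
cost, which is at most the lower limit of the average costs of any stationary policy. -/
lemma Policy.IsOptimal.limsup_le_liminf {β : ℝ} (hβ : 0 ≤ β) {g : M.StationaryPolicy}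
    (h : g.toPolicy.IsOptimal β) (g' : M.StationaryPolicy) (x : M.State) :
    M.avgLagrangian β g.toPolicy x ≠ ∞ ∧ M.avgLagrangian β g.toPolicy x ≤
      liminf (fun n : ℕ => M.totalCost (fun s u => ENNReal.ofReal (s.q + β * M.gridPower s u))
        g'.toPolicy x n / n) atTop := by
  have hc (s : M.State) (u : Action) : ENNReal.ofReal (s.q + β * M.gridPower s u) ≠ ∞ :=
    ENNReal.ofReal_ne_top
  obtain ⟨K, hK, hle⟩ := exists_averageCost_le hc h x.q
  refine ⟨ne_top_of_le_ne_top hK (hle x le_rfl), averageCost_le_liminf hc (fun s u => ?_) h g' x⟩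
  rw [ofReal_lagrangian hβ]
  exact le_self_add

lemma avgLagrangian_mono {β₁ β₂ : ℝ} (hβ : β₁ ≤ β₂) (g : M.StationaryPolicy) (x : M.State) :
    M.avgLagrangian β₁ g.toPolicy x ≤ M.avgLagrangian β₂ g.toPolicy x := by
  refine limsup_le_limsup (Eventually.of_forall fun n => ?_)
  simp only [StationaryPolicy.totalCost_eq]
  gcongr
  refine MarkovChain.total_mono _ (fun y => ?_) n x
  gcongr
  exact le_max_right _ _

end HarvestModel

theorem lemma6 (M : HarvestModel) (β₁ β₂ : ℝ) (hβ₁ : 0 < β₁) (hβ : β₁ < β₂)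
    (g₁ g₂ : M.StationaryPolicy)
    (h₁ : g₁.toPolicy.IsOptimal β₁) (h₂ : g₂.toPolicy.IsOptimal β₂) (x : M.State) :
    M.avgLagrangian β₁ g₁.toPolicy x ≤ M.avgLagrangian β₂ g₂.toPolicy x ∧
    M.avgBuffer g₁.toPolicy x ≤ M.avgBuffer g₂.toPolicy x ∧
    M.avgGrid g₂.toPolicy x ≤ M.avgGrid g₁.toPolicy x := by
  have hβ₂ : 0 < β₂ := hβ₁.trans hβ
  refine ⟨(h₁ x g₂.toPolicy).trans (HarvestModel.avgLagrangian_mono hβ.le g₂ x), ?_⟩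
  obtain ⟨f₁, i₁⟩ := h₁.limsup_le_liminf hβ₁.le g₂ x
  obtain ⟨f₂, i₂⟩ := h₂.limsup_le_liminf hβ₂.le g₁ x
  simp only [HarvestModel.avgLagrangian, HarvestModel.averageCost,
    HarvestModel.StationaryPolicy.totalCost_lagrangian hβ₁.le,
    HarvestModel.StationaryPolicy.totalCost_lagrangian hβ₂.le] at f₁ i₁ f₂ i₂
  exact limsup_le_limsup_of_exchange (Real.toNNReal_pos.2 hβ₁)
    ((Real.toNNReal_lt_toNNReal_iff hβ₂).2 hβ) i₁ f₁ i₂ f₂
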